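/- **Setting.** A *correlation monotone* $C$ assigns to every state (density operator) $\rho$ of a bipartite system $AB$, with $A$ finite-dimensional and $B$ arbitrary, a number $C(\rho)\ge 0$ such that $C$ vanishes on product states and is nonincreasing under quantum operations performed on $A$ alone or on $B$ alone. An *entanglement monotone* $E$ is a nonnegative function of the states of finite-dimensional bipartite systems that vanishes on separable states and is nonincreasing under local operations and classical communication. For $d\ge 1$ let $\mathcal E_d$ be the set of probability vectors with at most $d$ nonzero components, in decreasing order, padded with zeros to $d$ components. Let $f(\boldsymbol p)$ be the value of $C$ on the pure states with Schmidt coefficients $\sqrt{p_i}$, i.e. $f(\boldsymbol p)=C(|\psi\rangle\langle\psi|)$ with $|\psi\rangle=\sum_i\sqrt{p_i}\,|i\rangle|i\rangle$, and let $c_d=\sup_{\mathcal E_d} f$. For integers $d_1,d_2$ put $d=d_1d_2$, let $e$ be the largest value of $E$ on the states on $\mathbb C^{d_1}\otimes\mathbb C^{d_2}$, and define $$s(\boldsymbol p)=e-\sup_{\{|i\rangle\}}E\Big(\sum_i p_i|i\rangle\langle i|\Big)\quad(\boldsymbol p\in\mathcal E_d),\qquad g(x)=\inf\{s(\boldsymbol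 p):\boldsymbol p\in\mathcal E_d,\ f(\boldsymbol p)=x\},$$ $$\xi_{d_1,d_2}(x)=e-g(x)\quad(0\le x\le c_d),$$ where the supremum is over the orthonormal bases $\{|i\rangle\}$ of $\mathbb C^{d_1}\otimes\mathbb C^{d_2}$. The Rényi entropy of order $\alpha$ is $s_{R\alpha}(\boldsymbol p)=\frac{1}{1-\alpha}\ln\sum_i p_i^\alpha$ for $\alpha\ne1$, and $s_{R1}(\boldsymbol p)=-\sum_i p_i\ln p_i$. **Statement.** Let $C$ be a correlation monotone whose function $f$ is continuous on every $\mathcal E_d$. Suppose that $f=k\circ s_{R\alpha}$ for some $\alpha\in(0,1]$ and some strictly increasing function $k$ on $[0,\infty)$. Then for all integers $d_2\ge d_1\ge 2$ and every entanglement monotone $E$ there is a threshold $x_0$ with $0\le x_0<c_d$, where $d=d_1d_2$, such that 1. $\xi_{d_1,d_2}(x)=0$ for all $x\in[x_0,c_d]$; 2. for every system $B$ and every state $\rho$ of $AB$, where $A$ has the Hilbert space $\mathbb C^{d_1}\otimes\mathbb C^{d_2}$: if $C(\rho)\ge x_0$, then $E(\rho_A)=0$, where $\rho_A=\operatorname{tr}_B\rho$.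 -/

import Mathlib

open scoped Kronecker ComplexOrder

namespace InternalEntanglement

/-! ### States and operations

A system is described by the index set `a` of an orthonormal basis of its Hilbert space `ℓ²(a)`;
`a` may be finite or infinite. States are given by their matrix elements. -/

/-- Density operators on `ℓ²(a)`: positive semidefinite matrices with trace one. (Positivity and
summability of the diagonal make the matrix that of a trace class operator if `a` is infinite.) -/
def IsDensity {a : Type} (ρ : Matrix a a ℂ) : Prop :=
  ρ.PosSemidef ∧ HasSum (fun i => ρ i i) 1

/-- The reduced density operator `ρ_A = tr_B ρ`. -/
noncomputable def reduced {a b : Type} (ρ : Matrix (a × b) (a × b) ℂ) : Matrix a a ℂ :=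
  Matrix.of fun i j => ∑' l, ρ (i, l) (j, l)

open Classical in
/-- `K` is the family of Kraus operators `ℓ²(a) → ℓ²(a')` of a quantum operation:
`∑ₖ Kₖ† Kₖ = 1`. -/
def IsKraus {a a' κ : Type} (K : κ → Matrix a' a ℂ) : Prop :=
  ∀ i j, HasSum (fun q : κ × a' => star (K q.1 q.2 i) * K q.1 q.2 j) (if i = j then 1 else 0)

/-- The operation with Kraus operators `Kₖ`, performed on the first system of a bipartite state:
`∑ₖ (Kₖ ⊗ 1) ρ (Kₖ ⊗ 1)†`. -/
noncomputable def opLeft {a a' b κ : Type} (K : κ → Matrix a' a ℂ)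
    (ρ : Matrix (a × b) (a × b) ℂ) : Matrix (a' × b) (a' × b) ℂ :=
  Matrix.of fun x y => ∑' k, ∑' i, ∑' j, K k x.1 i * ρ (i, x.2) (j, y.2) * star (K k y.1 j)

/-- The operation with Kraus operators `Kₖ`, performed on the second system of a bipartite state:
`∑ₖ (1 ⊗ Kₖ) ρ (1 ⊗ Kₖ)†`. -/
noncomputable def opRight {a b b' κ : Type} (K : κ → Matrix b' b ℂ)
    (ρ : Matrix (a × b) (a × b) ℂ) : Matrix (a × b') (a × b') ℂ :=
  Matrix.of fun x y => ∑' k, ∑' i, ∑' j, K k x.2 i * ρ (x.1, i) (y.1, j) * star (K k y.2 j)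

/-! ### Correlation monotones -/

/-- A real function of the states shared by a finite-dimensional system `A` and any system `B`.
Only its values on density operators are ever used. -/
abbrev CorrelationMeasure : Type 1 :=
  ∀ (a b : Type) [Finite a], Matrix (a × b) (a × b) ℂ → ℝ

/-- Correlation monotones: nonnegative, zero on product states, nonincreasing under operations
performed on one of the two systems. -/
structure IsCorrelationMonotone (C : CorrelationMeasure) : Prop where
  nonneg : ∀ (a b : Type) [Finite a] (ρ : Matrix (a × b) (a × b) ℂ), IsDensity ρ → 0 ≤ C a b ρ
  product : ∀ (a b : Type) [Finite a] (σ : Matrix a a ℂ) (τ : Matrix b b ℂ),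
    IsDensity σ → IsDensity τ → C a b (σ ⊗ₖ τ) = 0
  mono_left : ∀ (a a' b κ : Type) [Finite a] [Finite a'] (K : κ → Matrix a' a ℂ), IsKraus K →
    ∀ ρ : Matrix (a × b) (a × b) ℂ, IsDensity ρ → C a' b (opLeft K ρ) ≤ C a b ρ
  mono_right : ∀ (a b b' κ : Type) [Finite a] (K : κ → Matrix b' b ℂ), IsKraus K →
    ∀ ρ : Matrix (a × b) (a × b) ℂ, IsDensity ρ → C a b' (opRight K ρ) ≤ C a b ρ

/-! ### Probability vectors and Rényi entropies -/

/-- The set `𝓔_d` of the probability vectors with at most `d` nonzero components, in decreasing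
order, padded with zeros to `d` components. -/
def probVec (d : ℕ) : Set (Fin d → ℝ) :=
  {p | p ∈ stdSimplex ℝ (Fin d) ∧ Antitone p}

/-- The Rényi entropy of order `α` (the Shannon entropy if `α = 1`). -/
noncomputable def renyi (α : ℝ) {d : ℕ} (p : Fin d → ℝ) : ℝ :=
  if α = 1 then ∑ i, Real.negMulLog (p i) else (1 - α)⁻¹ * Real.log (∑ i, p i ^ α)

/-- The vector `∑ᵢ √pᵢ |i⟩|i⟩`. -/
noncomputable def schmidtVec {d : ℕ} (p : Fin d → ℝ) : Fin d × Fin d → ℂ :=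
  fun x => if x.1 = x.2 then (√(p x.1) : ℂ) else 0

/-- The function `f` with `C(|ψ⟩⟨ψ|) = f(p)` for the pure states `|ψ⟩` with Schmidt
coefficients `√pᵢ`. -/
noncomputable def pureValue (C : CorrelationMeasure) {d : ℕ} (p : Fin d → ℝ) : ℝ :=
  C (Fin d) (Fin d) (Matrix.vecMulVec (schmidtVec p) (star (schmidtVec p)))

/-- The supremum `c_d` of `f` on `𝓔_d`. -/
noncomputable def corrMax (C : CorrelationMeasure) (d : ℕ) : ℝ :=
  sSup (pureValue C '' probVec d)

/-! ### Entanglement monotones -/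

/-- Matrices of operators on `ℂ^m ⊗ ℂ^n`. -/
abbrev BiMat (m n : ℕ) : Type := Matrix (Fin m × Fin n) (Fin m × Fin n) ℂ

/-- Separable states: mixtures of product states. -/
def IsSeparable {m n : ℕ} (ρ : BiMat m n) : Prop :=
  ∃ (r : ℕ) (q : Fin r → ℝ) (σ : Fin r → Matrix (Fin m) (Fin m) ℂ)
    (τ : Fin r → Matrix (Fin n) (Fin n) ℂ),
    q ∈ stdSimplex ℝ (Fin r) ∧ (∀ k, IsDensity (σ k)) ∧ (∀ k, IsDensity (τ k)) ∧
      ρ = ∑ k, (q k : ℂ) • (σ k ⊗ₖ τ k)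

/-- State transformations involving only local operations and classical communication: at each
step one party performs a measurement with Kraus operators `Kₖ` on her or his system and
communicates the outcome `k`, on which the rest `Φₖ` of the protocol may depend. The dimension of
the measured system may change. -/
inductive IsLOCC {m' n' : ℕ} : ∀ {m n : ℕ}, (BiMat m n → BiMat m' n') → Prop
  | done : IsLOCC (fun ρ : BiMat m' n' => ρ)
  | left {m n r : ℕ} (l : Fin r → ℕ) (K : ∀ k, Matrix (Fin (l k)) (Fin m) ℂ)
      (hK : ∑ k, (K k).conjTranspose * K k = 1) (Φ : ∀ k, BiMat (l k) n → BiMat m' n')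
      (hΦ : ∀ k, IsLOCC (Φ k)) :
      IsLOCC (fun ρ : BiMat m n => ∑ k, Φ k
        ((K k ⊗ₖ (1 : Matrix (Fin n) (Fin n) ℂ)) * ρ *
          (K k ⊗ₖ (1 : Matrix (Fin n) (Fin n) ℂ)).conjTranspose))
  | right {m n r : ℕ} (l : Fin r → ℕ) (K : ∀ k, Matrix (Fin (l k)) (Fin n) ℂ)
      (hK : ∑ k, (K k).conjTranspose * K k = 1) (Φ : ∀ k, BiMat m (l k) → BiMat m' n')
      (hΦ : ∀ k, IsLOCC (Φ k)) :
      IsLOCC (fun ρ : BiMat m n => ∑ k, Φ k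
        (((1 : Matrix (Fin m) (Fin m) ℂ) ⊗ₖ K k) * ρ *
          ((1 : Matrix (Fin m) (Fin m) ℂ) ⊗ₖ K k).conjTranspose))

/-- A real function of the states of finite-dimensional bipartite systems. Only its values on
density operators are ever used. -/
abbrev EntanglementMeasure : Type := ∀ m n : ℕ, BiMat m n → ℝ

/-- Entanglement monotones: nonnegative, zero on separable states, nonincreasing under local
operations and classical communication. -/
structure IsEntanglementMonotone (E : EntanglementMeasure) : Prop where
  nonneg : ∀ (m n : ℕ) (ρ : BiMat m n), IsDensity ρ → 0 ≤ E m n ρ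
  separable : ∀ (m n : ℕ) (ρ : BiMat m n), IsSeparable ρ → E m n ρ = 0
  mono : ∀ (m n m' n' : ℕ) (Φ : BiMat m n → BiMat m' n'), IsLOCC Φ →
    ∀ ρ : BiMat m n, IsDensity ρ → E m' n' (Φ ρ) ≤ E m n ρ

/-! ### The bound on the internal entanglement -/

/-- The largest value `e` of `E` on the states on `ℂ^{d₁} ⊗ ℂ^{d₂}`. -/
noncomputable def entMax (E : EntanglementMeasure) (d₁ d₂ : ℕ) : ℝ :=
  sSup (E d₁ d₂ '' {ρ | IsDensity ρ})

/-- The operator `∑ᵢ pᵢ |i⟩⟨i|`, for an orthonormal basis `|i⟩` of `ℂ^{d₁} ⊗ ℂ^{d₂}`. -/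
noncomputable def mixture {d₁ d₂ : ℕ} (p : Fin (d₁ * d₂) → ℝ)
    (v : OrthonormalBasis (Fin (d₁ * d₂)) ℂ (EuclideanSpace ℂ (Fin d₁ × Fin d₂))) : BiMat d₁ d₂ :=
  Matrix.of fun x y => ∑ i, (p i : ℂ) * v i x * star (v i y)

/-- `s(p) = e - sup E(∑ᵢ pᵢ |i⟩⟨i|)`, with the supremum over the orthonormal bases. -/
noncomputable def mixedness (E : EntanglementMeasure) (d₁ d₂ : ℕ) (p : Fin (d₁ * d₂) → ℝ) : ℝ :=
  entMax E d₁ d₂ -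
    ⨆ v : OrthonormalBasis (Fin (d₁ * d₂)) ℂ (EuclideanSpace ℂ (Fin d₁ × Fin d₂)),
      E d₁ d₂ (mixture p v)

/-- `g(x)`, the infimum of `s` over the `p ∈ 𝓔_d` with `f(p) = x`, where `d = d₁ d₂`. -/
noncomputable def minMixedness (C : CorrelationMeasure) (E : EntanglementMeasure) (d₁ d₂ : ℕ)
    (x : ℝ) : ℝ :=
  sInf (mixedness E d₁ d₂ '' {p | p ∈ probVec (d₁ * d₂) ∧ pureValue C p = x})

/-- The bound `ξ = e - g` on the internal entanglement, for `x ∈ [0, c_d]`. -/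
noncomputable def xi (C : CorrelationMeasure) (E : EntanglementMeasure) (d₁ d₂ : ℕ) (x : ℝ) : ℝ :=
  entMax E d₁ d₂ - minMixedness C E d₁ d₂ x

end InternalEntanglement

/-! Two facts carry the proof. The first is the bound C(ρ) ≤ f(p) with p the spectrum of ρ_A
(`IsCorrelationMonotone.le_pureValue`): every extension of ρ_A arises from its purification by an
operation on B, and the purification arises from the Schmidt state of p by an isometry on A. The
second is that a neighbourhood of the maximally mixed state consists of separable states
(`isSeparable_mixture`): if all p_i ≥ t, for an explicit t < 1/d, then ∑ p_i |i⟩⟨i| is separable for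
every orthonormal basis.

By strict concavity (`renyi_lt_renyi_uniform`) the uniform vector is the only maximiser of f on 𝓔_d.
The vectors with some component ≤ t form a compact set that misses it, so f stays below some x₀ <
c_d there. Hence f(p) ≥ x₀ forces all mixtures with weights p to be separable, and E vanishes on
them; both claims follow. -/

namespace InternalEntanglement

/-! ### Rank one decompositions and the partial trace -/

/-- A positive semidefinite kernel is a sum of rank one kernels. -/
theorem exists_hasSum_of_posSemidef {X : Type} {ρ : Matrix X X ℂ} (h : ρ.PosSemidef) :
    ∃ (κ : Type) (φ : κ → X → ℂ), ∀ i j, HasSum (fun k => φ k i * star (φ k j)) (ρ i j) := by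
  -- Scalars are viewed as operators on ℂ, to fit the operator-valued kernels of `RKHS`. Parseval's
  -- identity in a Hilbert basis of the reproducing kernel space then expands ρ i j.
  let K : Matrix X X (ℂ →L[ℂ] ℂ) := .of fun x y => ρ x y • ContinuousLinearMap.id ℂ ℂ
  have hK : K.PosSemidef := by
    have h0 : K.PosSemidef ↔ K.IsHermitian ∧ ∀ v : X →₀ ℂ,
        0 ≤ RCLike.re (v.sum fun x w => v.sum fun x' w' => inner ℂ (K x' x w) w') :=
      RKHS.posSemidef_tfae.out 0 2
    refine h0.mpr ⟨?_, fun v => ?_⟩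
    · ext1 x y
      refine ContinuousLinearMap.ext_ring (ext_inner_right ℂ fun w => ?_)
      have := h.1.apply x y
      rw [Matrix.conjTranspose_apply, ContinuousLinearMap.star_eq_adjoint,
        ContinuousLinearMap.adjoint_inner_left]
      simp [K, ← this]
      ring
    · have := (Complex.nonneg_iff.1 (h.2 v)).1
      refine this.trans_eq (congrArg Complex.re ?_)
      unfold Finsupp.sum
      refine Finset.sum_congr rfl fun x _ => Finset.sum_congr rfl fun y _ => ?_
      have := h.1.apply x y
      simp [K, ← this]
      ring
  have : Fact K.PosSemidef := ⟨hK⟩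
  obtain ⟨w, e, -⟩ := exists_hilbertBasis ℂ (RKHS.OfKernel K)
  refine ⟨w, fun k x => inner ℂ (RKHS.kerFun (RKHS.OfKernel K) x (1 : ℂ)) (e k), fun i j => ?_⟩
  have h1 := RKHS.kernel_inner (RKHS.OfKernel K) j i (1 : ℂ) (1 : ℂ)
  rw [RKHS.OfKernel.kernel_ofKernel] at h1
  have h2 := e.hasSum_inner_mul_inner (RKHS.kerFun (RKHS.OfKernel K) i (1 : ℂ))
    (RKHS.kerFun (RKHS.OfKernel K) j (1 : ℂ))
  rw [← h1] at h2
  have h3 : inner ℂ (K j i 1) (1 : ℂ) = ρ i j := by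
    have := h.1.apply i j
    simpa [K] using this
  rw [h3] at h2
  simpa using h2

variable {a b κ : Type} {ρ : Matrix (a × b) (a × b) ℂ}

theorem summable_norm_sq_of_hasSum (hρ : IsDensity ρ) {φ : κ → a × b → ℂ}
    (hφ : ∀ x y, HasSum (fun k => φ k x * star (φ k y)) (ρ x y)) (i : a) :
    Summable fun q : κ × b => ‖φ q.1 (i, q.2)‖ ^ 2 := by
  have h1 : ∀ l, HasSum (fun k => ‖φ k (i, l)‖ ^ 2) (ρ (i, l) (i, l)).re := fun l => by
    convert Complex.hasSum_re (hφ (i, l) (i, l)) using 2 with k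
    rw [Complex.star_def, Complex.mul_conj, Complex.ofReal_re, Complex.sq_norm]
  have h2 : Summable fun l => (ρ (i, l) (i, l)).re :=
    (Complex.hasSum_re hρ.2).summable.comp_injective (Prod.mk_right_injective i)
  rw [← (Equiv.prodComm b κ).summable_iff]
  refine (summable_prod_of_nonneg fun _ => by
    simp only [Function.comp, Pi.zero_apply]; positivity).2
    ⟨fun l => (h1 l).summable, ?_⟩
  refine h2.congr fun l => ?_
  exact (h1 l).tsum_eq.symm

/-- Finite trace makes the amplitudes square summable over `κ × b`; the products are then absolutely
summable, and the sums over `k` and over `b` may be interchanged. -/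
theorem hasSum_reduced (hρ : IsDensity ρ) {φ : κ → a × b → ℂ}
    (hφ : ∀ x y, HasSum (fun k => φ k x * star (φ k y)) (ρ x y)) (i j : a) :
    HasSum (fun q : κ × b => φ q.1 (i, q.2) * star (φ q.1 (j, q.2))) (reduced ρ i j) := by
  have hs : Summable fun q : κ × b => φ q.1 (i, q.2) * star (φ q.1 (j, q.2)) := by
    refine Summable.of_norm_bounded ((summable_norm_sq_of_hasSum hρ hφ i).add
      (summable_norm_sq_of_hasSum hρ hφ j)) fun q => ?_
    rw [norm_mul, norm_star]
    nlinarith [sq_nonneg (‖φ q.1 (i, q.2)‖ - ‖φ q.1 (j, q.2)‖), sq_nonneg (‖φ q.1 (i, q.2)‖),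
      sq_nonneg (‖φ q.1 (j, q.2)‖)]
  have h := (Equiv.prodComm b κ).hasSum_iff.2 hs.hasSum
  have := h.prod_fiberwise (fun l => hφ (i, l) (j, l))
  have h2 : reduced ρ i j = _ := this.tsum_eq
  rw [h2]
  exact hs.hasSum

theorem summable_reduced (hρ : IsDensity ρ) (i j : a) :
    Summable fun l => ρ (i, l) (j, l) := by
  obtain ⟨κ, φ, hφ⟩ := exists_hasSum_of_posSemidef hρ.1
  exact ((Equiv.prodComm b κ).hasSum_iff.2 (hasSum_reduced hρ hφ i j)).prod_fiberwise
    (fun l => hφ (i, l) (j, l)) |>.summable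

theorem IsDensity.reduced (hρ : IsDensity ρ) : IsDensity (reduced ρ) := by
  refine ⟨⟨?_, fun x => ?_⟩, ?_⟩
  · ext i j
    simp only [Matrix.conjTranspose_apply, InternalEntanglement.reduced, Matrix.of_apply, tsum_star]
    exact tsum_congr fun l => hρ.1.1.apply _ _
  · have : HasSum (fun l => x.sum fun i xi => x.sum fun j xj => star xi * ρ (i, l) (j, l) * xj)
        (x.sum fun i xi => x.sum fun j xj => star xi * InternalEntanglement.reduced ρ i j * xj) :=
      hasSum_sum fun i _ => hasSum_sum fun j _ =>
        ((summable_reduced hρ i j).hasSum.mul_left _).mul_right _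
    exact this.nonneg fun l => (hρ.1.submatrix fun i => (i, l)).2 x
  · exact hρ.2.prod_fiberwise fun i => (summable_reduced hρ i i).hasSum

/-! ### Pure states and local operations on them -/

theorem isDensity_vecMulVec {x : Type} [Fintype x] {ψ : x → ℂ} (h : ∑ i, ‖ψ i‖ ^ 2 = 1) :
    IsDensity (Matrix.vecMulVec ψ (star ψ)) := by
  refine ⟨Matrix.posSemidef_vecMulVec_self_star ψ, ?_⟩
  convert hasSum_fintype _
  rw [← Complex.ofReal_one, ← h, Complex.ofReal_sum]
  refine Finset.sum_congr rfl fun i _ => ?_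
  simp [Matrix.vecMulVec_apply, Complex.mul_conj, Complex.normSq_eq_norm_sq]

theorem isDensity_schmidtVec {d : ℕ} {p : Fin d → ℝ} (hp : p ∈ stdSimplex ℝ (Fin d)) :
    IsDensity (Matrix.vecMulVec (schmidtVec p) (star (schmidtVec p))) := by
  refine isDensity_vecMulVec ?_
  rw [← hp.2, Fintype.sum_prod_type]
  refine Finset.sum_congr rfl fun s _ => ?_
  rw [Finset.sum_eq_single s (fun t _ hts => by simp [schmidtVec, Ne.symm hts]) (by simp)]
  simp [schmidtVec, Real.sq_sqrt (hp.1 s)]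

theorem opLeft_vecMulVec {a a' b : Type} [Fintype a] (W : Matrix a' a ℂ) (ψ : a × b → ℂ) :
    opLeft (fun _ : Unit => W) (Matrix.vecMulVec ψ (star ψ)) =
      Matrix.vecMulVec (fun x => ∑ i, W x.1 i * ψ (i, x.2))
        (star fun x => ∑ i, W x.1 i * ψ (i, x.2)) := by
  ext x y
  simp only [opLeft, Matrix.of_apply, tsum_fintype, Matrix.vecMulVec_apply, Pi.star_apply,
    star_sum, star_mul', Finset.sum_mul_sum, Finset.univ_unique, Finset.sum_singleton]
  exact Finset.sum_congr rfl fun i _ => Finset.sum_congr rfl fun j _ => by ring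

theorem opRight_vecMulVec {a b b' κ : Type} [Fintype b] (K : κ → Matrix b' b ℂ) (ψ : a × b → ℂ)
    (x y : a × b') :
    opRight K (Matrix.vecMulVec ψ (star ψ)) x y =
      ∑' k, (∑ i, K k x.2 i * ψ (x.1, i)) * star (∑ i, K k y.2 i * ψ (y.1, i)) := by
  simp only [opRight, Matrix.of_apply, tsum_fintype, Matrix.vecMulVec_apply, Pi.star_apply,
    star_sum, star_mul', Finset.sum_mul_sum]
  exact tsum_congr fun k => Finset.sum_congr rfl fun i _ => Finset.sum_congr rfl fun j _ => by ring

theorem sum_star_mul_basis {a : Type} [Fintype a] {d : ℕ}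
    (v : OrthonormalBasis (Fin d) ℂ (EuclideanSpace ℂ a)) (s t : Fin d) :
    ∑ i, star (v s i) * v t i = if s = t then 1 else 0 := by
  rw [← orthonormal_iff_ite.1 v.orthonormal s t, PiLp.inner_apply]
  exact Finset.sum_congr rfl fun i _ => by simp [mul_comm]

theorem sum_basis_mul_sum {a : Type} [Fintype a] {d : ℕ}
    (v : OrthonormalBasis (Fin d) ℂ (EuclideanSpace ℂ a)) (f : a → ℂ) (i : a) :
    ∑ s, v s i * ∑ j, star (v s j) * f j = f i := by
  have := congrArg (fun w : EuclideanSpace ℂ a => w i) (v.sum_repr (WithLp.toLp 2 f))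
  simp only [WithLp.ofLp_sum, Finset.sum_apply, v.repr_apply_apply, PiLp.inner_apply] at this
  rw [← this]
  refine Finset.sum_congr rfl fun s _ => ?_
  simp [mul_comm]

/-! ### Every extension of ρ_A comes from its purification -/

section Purification

variable {a b κ : Type} [Fintype a] {d : ℕ} {ρ : Matrix (a × b) (a × b) ℂ}
  {φ : κ → a × b → ℂ} {p : Fin d → ℝ} {v : OrthonormalBasis (Fin d) ℂ (EuclideanSpace ℂ a)}

/-- This is the Schmidt decomposition of the purification ∑ₖ |φₖ⟩|k⟩: in an eigenbasis of ρ_A, the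
relative vectors in ℓ²(κ × b) are orthogonal with squared norms p_s. -/
theorem hasSum_coeff (hρ : IsDensity ρ)
    (hφ : ∀ x y, HasSum (fun k => φ k x * star (φ k y)) (ρ x y))
    (hv : ∀ i j, reduced ρ i j = ∑ s, (p s : ℂ) * v s i * star (v s j)) (s t : Fin d) :
    HasSum (fun q : κ × b => star (∑ i, star (v s i) * φ q.1 (i, q.2)) *
      ∑ j, star (v t j) * φ q.1 (j, q.2)) (if s = t then (p s : ℂ) else 0) := by
  have h : HasSum (fun q : κ × b => ∑ i, ∑ j, v s i * star (v t j) *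
      (φ q.1 (j, q.2) * star (φ q.1 (i, q.2))))
      (∑ i, ∑ j, v s i * star (v t j) * reduced ρ j i) :=
    hasSum_sum fun i _ => hasSum_sum fun j _ => (hasSum_reduced hρ hφ j i).mul_left _
  convert h using 1
  · ext q
    simp only [star_sum, star_mul', star_star, Finset.sum_mul_sum]
    exact Finset.sum_congr rfl fun i _ => Finset.sum_congr rfl fun j _ => by ring
  · have e : ∀ i, ∑ j, v s i * star (v t j) * reduced ρ j i =
        (p t : ℂ) * (star (v t i) * v s i) := fun i => by
      simp only [hv, Finset.mul_sum]
      rw [Finset.sum_comm]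
      have : ∀ u, ∑ j, v s i * star (v t j) * (↑(p u) * v u j * star (v u i)) =
          v s i * p u * star (v u i) * ∑ j, star (v t j) * v u j := fun u => by
        rw [Finset.mul_sum]
        exact Finset.sum_congr rfl fun j _ => by ring
      simp only [this, sum_star_mul_basis, mul_ite, mul_one, mul_zero, Finset.sum_ite_eq,
        Finset.mem_univ, if_true]
      ring
    simp only [e, ← Finset.mul_sum, sum_star_mul_basis]
    by_cases hst : s = t
    · simp [hst]
    · simp [hst, Ne.symm hst]

open Classical in
/-- Kraus operators which turn the purification `∑ₛ √pₛ |vₛ⟩|s⟩` of the reduced state into the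
state `∑ₖ |φₖ⟩⟨φₖ|`. -/
noncomputable def purificationKraus (φ : κ → a × b → ℂ) (p : Fin d → ℝ)
    (v : OrthonormalBasis (Fin d) ℂ (EuclideanSpace ℂ a)) (l₀ : b) :
    κ ⊕ Fin d → Matrix b (Fin d) ℂ
  | .inl k => Matrix.of fun l s => (√(p s) : ℂ)⁻¹ * ∑ i, star (v s i) * φ k (i, l)
  -- For p_s = 0 the first family has a zero column, because 0⁻¹ = 0. These operators send such |s⟩
  -- to |l₀⟩, which restores ∑ K†K = 1; they annihilate the purification.
  | .inr t => Matrix.of fun l s => if (t, l) = (s, l₀) then (if p s = 0 then 1 else 0) else 0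

theorem isKraus_purificationKraus (hρ : IsDensity ρ)
    (hφ : ∀ x y, HasSum (fun k => φ k x * star (φ k y)) (ρ x y)) (hp : ∀ s, 0 ≤ p s)
    (hv : ∀ i j, reduced ρ i j = ∑ s, (p s : ℂ) * v s i * star (v s j)) (l₀ : b) :
    IsKraus (purificationKraus φ p v l₀) := by
  classical
  intro s t
  rw [← (Equiv.sumProdDistrib κ (Fin d) b).symm.hasSum_iff]
  have h1 := (hasSum_coeff hρ hφ hv s t).mul_left ((√(p s) : ℂ)⁻¹ * (√(p t) : ℂ)⁻¹)
  have h2 : HasSum (fun q : Fin d × b => star (purificationKraus φ p v l₀ (.inr q.1) q.2 s) *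
      purificationKraus φ p v l₀ (.inr q.1) q.2 t)
      (if s = t then (if p s = 0 then 1 else 0) else 0) := by
    convert hasSum_ite_eq (s, l₀)
      (if s = t then (if p s = 0 then (1 : ℂ) else 0) else 0) using 2 with q
    obtain ⟨u, l⟩ := q
    simp only [purificationKraus, Matrix.of_apply, Prod.mk.injEq]
    by_cases hu : u = s
    · subst hu
      by_cases hl : l = l₀ <;> by_cases hut : u = t <;> by_cases hpu : p u = 0 <;>
        simp_all
    · simp [hu]
  have h1' : HasSum (fun q : κ × b => star (purificationKraus φ p v l₀ (.inl q.1) q.2 s) *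
      purificationKraus φ p v l₀ (.inl q.1) q.2 t) ((√(p s) : ℂ)⁻¹ * (√(p t) : ℂ)⁻¹ *
        (if s = t then (p s : ℂ) else 0)) := by
    refine (congrArg (HasSum · _) (funext fun q => ?_)).mp h1
    simp only [purificationKraus, Matrix.of_apply, star_mul', star_inv₀, Complex.star_def,
      Complex.conj_ofReal]
    ring
  convert HasSum.sum (f := (fun q : (κ ⊕ Fin d) × b =>
    star (purificationKraus φ p v l₀ q.1 q.2 s) * purificationKraus φ p v l₀ q.1 q.2 t) ∘
      (Equiv.sumProdDistrib κ (Fin d) b).symm) h1' h2 using 1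
  by_cases hst : s = t
  · subst hst
    by_cases hs : p s = 0
    · simp [hs]
    · have : (√(p s) : ℂ) ≠ 0 := by
        rw [Complex.ofReal_ne_zero, Real.sqrt_ne_zero (hp s)]; exact hs
      have e : (p s : ℂ) = √(p s) * √(p s) := by
        rw [← Complex.ofReal_mul, Real.mul_self_sqrt (hp s)]
      simp only [hs, if_true, if_false, add_zero]
      rw [e]
      field_simp
  · simp [hst]

theorem opRight_purificationKraus (hρ : IsDensity ρ)
    (hφ : ∀ x y, HasSum (fun k => φ k x * star (φ k y)) (ρ x y)) (hp : ∀ s, 0 ≤ p s)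
    (hv : ∀ i j, reduced ρ i j = ∑ s, (p s : ℂ) * v s i * star (v s j)) (l₀ : b)
    {ψ : a × Fin d → ℂ}
    (hψ : ∀ i s, ψ (i, s) = √(p s) * v s i) :
    opRight (purificationKraus φ p v l₀) (Matrix.vecMulVec ψ (star ψ)) = ρ := by
  -- The squared moduli of these amplitudes sum to p_s, so inverting √p_s as 0 loses nothing when
  -- p_s = 0.
  have h0 : ∀ s, p s = 0 → ∀ k l, ∑ i, star (v s i) * φ k (i, l) = 0 := fun s hs k l => by
    have h := Complex.hasSum_re (hasSum_coeff hρ hφ hv s s)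
    simp only [hs, if_true, Complex.ofReal_zero, Complex.zero_re] at h
    have e : ∀ z : ℂ, (star z * z).re = ‖z‖ ^ 2 := fun z => by
      rw [Complex.star_def, ← Complex.normSq_eq_conj_mul_self, Complex.ofReal_re, Complex.sq_norm]
    simp only [e] at h
    have := congrFun ((hasSum_zero_iff_of_nonneg fun q => by positivity).1 h) (k, l)
    simpa using this
  have h1 : ∀ k (x : a × b), ∑ s, purificationKraus φ p v l₀ (.inl k) x.2 s * ψ (x.1, s) =
      φ k x := by
    intro k x
    rw [← sum_basis_mul_sum v (fun i => φ k (i, x.2)) x.1]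
    refine Finset.sum_congr rfl fun s _ => ?_
    rw [hψ]
    simp only [purificationKraus, Matrix.of_apply]
    by_cases hs : p s = 0
    · rw [h0 s hs, mul_zero, mul_zero, zero_mul]
    · have : (√(p s) : ℂ) ≠ 0 := by
        rw [Complex.ofReal_ne_zero, Real.sqrt_ne_zero (hp s)]; exact hs
      field_simp
  have h2 : ∀ t (x : a × b), ∑ s, purificationKraus φ p v l₀ (.inr t) x.2 s * ψ (x.1, s) = 0 := by
    intro t x
    refine Finset.sum_eq_zero fun s _ => ?_
    rw [hψ]
    simp only [purificationKraus, Matrix.of_apply]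
    by_cases hs : p s = 0 <;> simp [hs]
  ext x y
  rw [opRight_vecMulVec]
  refine HasSum.tsum_eq ?_
  rw [← add_zero (ρ x y)]
  refine HasSum.sum ?_ ?_
  · simpa only [Function.comp_def, h1] using hφ x y
  · simp only [Function.comp_def, h2, zero_mul]
    exact hasSum_zero

end Purification

theorem IsCorrelationMonotone.le_pureValue {C : CorrelationMeasure} (hC : IsCorrelationMonotone C)
    {a b : Type} [Fintype a] {d : ℕ} {ρ : Matrix (a × b) (a × b) ℂ} (hρ : IsDensity ρ)
    {p : Fin d → ℝ} (hp : p ∈ stdSimplex ℝ (Fin d))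
    {v : OrthonormalBasis (Fin d) ℂ (EuclideanSpace ℂ a)}
    (hv : ∀ i j, reduced ρ i j = ∑ s, (p s : ℂ) * v s i * star (v s j)) :
    C a b ρ ≤ pureValue C p := by
  obtain ⟨κ, φ, hφ⟩ := exists_hasSum_of_posSemidef hρ.1
  -- A state on an empty index set would have trace 0; a point `l₀` of `b` is needed for the Kraus
  -- operators.
  have hne : Nonempty (a × b) := by
    by_contra h
    rw [not_nonempty_iff] at h
    exact one_ne_zero (hρ.2.unique hasSum_empty)
  obtain ⟨-, l₀⟩ := hne
  -- The isometry |s⟩ ↦ v_s takes the Schmidt state of p to ∑ √p_s |v_s⟩|s⟩.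
  set W : Matrix a (Fin d) ℂ := Matrix.of fun i s => v s i with hW
  have hWK : IsKraus (fun _ : Unit => W) := fun s t => by
    convert hasSum_fintype (fun q : Unit × a => star (W q.2 s) * W q.2 t)
    simp only [Fintype.sum_prod_type, Finset.univ_unique, Finset.sum_singleton, hW, Matrix.of_apply]
    rw [sum_star_mul_basis]
    congr
  have hS := isDensity_schmidtVec hp
  have hψ : ∀ i s, ∑ t, W i t * schmidtVec p (t, s) = √(p s) * v s i := fun i s => by
    simp [schmidtVec, hW, mul_comm]
  have hD : IsDensity (opLeft (fun _ : Unit => W)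
      (Matrix.vecMulVec (schmidtVec p) (star (schmidtVec p)))) := by
    rw [opLeft_vecMulVec]
    refine isDensity_vecMulVec ?_
    rw [← hp.2, Fintype.sum_prod_type_right]
    refine Finset.sum_congr rfl fun s _ => ?_
    simp only [hψ, norm_mul, mul_pow, ← Finset.mul_sum]
    rw [← EuclideanSpace.norm_sq_eq, v.norm_eq_one]
    simp [Real.sq_sqrt (hp.1 s)]
  refine le_trans ?_ (hC.mono_left _ _ _ _ _ hWK _ hS)
  have := hC.mono_right _ _ _ _ _ (isKraus_purificationKraus hρ hφ hp.1 hv l₀) _ hD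
  rw [opLeft_vecMulVec, opRight_purificationKraus hρ hφ hp.1 hv l₀ hψ] at this
  rwa [opLeft_vecMulVec]

/-! ### Separability near the maximally mixed state -/

variable {m n : ℕ}

/-- The cone generated by the products of positive semidefinite operators. -/
def sepCone (m n : ℕ) : AddSubmonoid (BiMat m n) :=
  AddSubmonoid.closure {X | ∃ (A : Matrix (Fin m) (Fin m) ℂ) (B : Matrix (Fin n) (Fin n) ℂ),
    A.PosSemidef ∧ B.PosSemidef ∧ X = A ⊗ₖ B}

theorem kronecker_mem_sepCone {A : Matrix (Fin m) (Fin m) ℂ} {B : Matrix (Fin n) (Fin n) ℂ}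
    (hA : A.PosSemidef) (hB : B.PosSemidef) : A ⊗ₖ B ∈ sepCone m n :=
  AddSubmonoid.subset_closure ⟨A, B, hA, hB, rfl⟩

theorem smul_mem_sepCone {X : BiMat m n} (hX : X ∈ sepCone m n) {r : ℝ} (hr : 0 ≤ r) :
    (r : ℂ) • X ∈ sepCone m n := by
  induction hX using AddSubmonoid.closure_induction with
  | mem X hX =>
    obtain ⟨A, B, hA, hB, rfl⟩ := hX
    rw [← Matrix.smul_kronecker]
    exact kronecker_mem_sepCone (hA.smul (Complex.zero_le_real.2 hr)) hB
  | zero => simp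
  | add X Y _ _ hX hY => rw [smul_add]; exact add_mem hX hY

theorem exists_smul_isDensity [NeZero m] {A : Matrix (Fin m) (Fin m) ℂ} (hA : A.PosSemidef) :
    ∃ (t : ℝ) (σ : Matrix (Fin m) (Fin m) ℂ), 0 ≤ t ∧ IsDensity σ ∧ A = (t : ℂ) • σ := by
  obtain ⟨t, ht, htA⟩ := RCLike.nonneg_iff_exists_ofReal.1 hA.trace_nonneg
  rcases ht.eq_or_lt with h0 | h0
  -- Any state serves when the weight is zero; the one chosen here exists because m ≠ 0.
  · have : A = 0 := hA.trace_eq_zero_iff.1 (by rw [← htA, ← h0]; simp)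
    refine ⟨0, Matrix.vecMulVec (Pi.single 0 1) (star (Pi.single 0 1)), le_rfl,
      isDensity_vecMulVec ?_, by simp [this]⟩
    rw [Finset.sum_eq_single 0 (fun j _ hj => by simp [hj]) (by simp)]
    simp
  · refine ⟨t, (t : ℂ)⁻¹ • A, ht, ⟨hA.smul ?_, ?_⟩, ?_⟩
    · rw [← Complex.ofReal_inv]
      exact Complex.zero_le_real.2 (inv_nonneg.2 ht)
    · convert hasSum_fintype _
      have : (t : ℂ) = ∑ i, A i i := htA
      simp only [Matrix.smul_apply, smul_eq_mul, ← Finset.mul_sum]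
      rw [← this, inv_mul_cancel₀ (Complex.ofReal_ne_zero.2 h0.ne')]
    · rw [smul_smul, mul_inv_cancel₀ (Complex.ofReal_ne_zero.2 h0.ne'), one_smul]

theorem exists_sum_of_mem_sepCone [NeZero m] [NeZero n] {X : BiMat m n} (hX : X ∈ sepCone m n) :
    ∃ (r : ℕ) (q : Fin r → ℝ) (σ : Fin r → Matrix (Fin m) (Fin m) ℂ)
      (τ : Fin r → Matrix (Fin n) (Fin n) ℂ), (∀ k, 0 ≤ q k) ∧ (∀ k, IsDensity (σ k)) ∧
      (∀ k, IsDensity (τ k)) ∧ X = ∑ k, (q k : ℂ) • (σ k ⊗ₖ τ k) := by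
  induction hX using AddSubmonoid.closure_induction with
  | mem X hX =>
    obtain ⟨A, B, hA, hB, rfl⟩ := hX
    obtain ⟨t, σ, ht, hσ, rfl⟩ := exists_smul_isDensity hA
    obtain ⟨u, τ, hu, hτ, rfl⟩ := exists_smul_isDensity hB
    refine ⟨1, fun _ => t * u, fun _ => σ, fun _ => τ, fun _ => mul_nonneg ht hu, fun _ => hσ,
      fun _ => hτ, ?_⟩
    simp only [Finset.univ_unique, Finset.sum_const, Finset.card_singleton, one_smul,
      Matrix.smul_kronecker, Matrix.kronecker_smul, smul_smul, Complex.ofReal_mul]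
    rw [mul_comm (u : ℂ)]
  | zero => exact ⟨0, Fin.elim0, Fin.elim0, Fin.elim0, nofun, nofun, nofun, by simp⟩
  | add X Y _ _ hX hY =>
    obtain ⟨r, q, σ, τ, hq, hσ, hτ, rfl⟩ := hX
    obtain ⟨r', q', σ', τ', hq', hσ', hτ', rfl⟩ := hY
    refine ⟨r + r', Fin.append q q', Fin.append σ σ', Fin.append τ τ',
      fun k => ?_, fun k => ?_, fun k => ?_, by simp [Fin.sum_univ_add]⟩
    all_goals
      refine Fin.addCases (fun i => ?_) (fun i => ?_) k <;> simp [hq, hσ, hτ, hq', hσ', hτ']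

theorem isSeparable_of_mem_sepCone [NeZero m] [NeZero n] {X : BiMat m n} (hX : X ∈ sepCone m n)
    (htr : X.trace = 1) : IsSeparable X := by
  obtain ⟨r, q, σ, τ, hq, hσ, hτ, rfl⟩ := exists_sum_of_mem_sepCone hX
  refine ⟨r, q, σ, τ, ⟨hq, ?_⟩, hσ, hτ, rfl⟩
  have h1 : ∀ {l : ℕ} {ω : Matrix (Fin l) (Fin l) ℂ}, IsDensity ω → ω.trace = 1 := fun h =>
    (hasSum_fintype _).unique h.2
  simp only [Matrix.trace_sum, Matrix.trace_smul, Matrix.trace_kronecker, h1 (hσ _), h1 (hτ _),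
    mul_one, smul_eq_mul] at htr
  exact_mod_cast htr

/-- 4 − A ⊗ B = (2 − A) ⊗ 2 + A ⊗ (2 − B). -/
theorem smul_one_sub_diagonal_kronecker_mem_sepCone {A : Fin m → ℂ} {B : Fin n → ℂ} (hA : 0 ≤ A)
    (hA2 : A ≤ 2) (hB2 : B ≤ 2) :
    (4 : ℂ) • 1 - Matrix.diagonal A ⊗ₖ Matrix.diagonal B ∈ sepCone m n := by
  have h1 := kronecker_mem_sepCone (Matrix.PosSemidef.diagonal (sub_nonneg.2 hA2))
    (Matrix.PosSemidef.diagonal (d := (2 : Fin n → ℂ)) (fun _ => by simp))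
  have h2 := kronecker_mem_sepCone (Matrix.PosSemidef.diagonal hA)
    (Matrix.PosSemidef.diagonal (sub_nonneg.2 hB2))
  convert add_mem h1 h2 using 1
  ext ⟨i, j⟩ ⟨k, l⟩
  simp only [Matrix.sub_apply, Matrix.smul_apply, Matrix.one_apply, Matrix.add_apply,
    Matrix.kroneckerMap_apply, Matrix.diagonal_apply, Prod.mk.injEq, Pi.sub_apply, smul_eq_mul]
  by_cases hik : i = k <;> by_cases hjl : j = l <;> simp [hik, hjl]
  ring

theorem single_mul_single {l : ℕ} (i x y : Fin l) :
    (Pi.single i 1 : Fin l → ℂ) x * (Pi.single i 1 : Fin l → ℂ) y =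
      if x = y then (Pi.single i 1 : Fin l → ℂ) x else 0 := by
  simp only [Pi.single_apply]
  by_cases hx : x = i <;> by_cases hy : y = i <;> simp_all
  intro h; exact absurd h.symm hy

theorem star_single_apply {l : ℕ} (i x : Fin l) :
    star ((Pi.single i 1 : Fin l → ℂ) x) = (Pi.single i 1 : Fin l → ℂ) x := by
  simp only [Pi.single_apply]
  split_ifs <;> simp

/-- Average the product vectors (e_i + θ e_k) ⊗ (e_j + conj(cθ) e_l) over the fourth roots of unity
θ. Terms in θ, θ² and their conjugates cancel, which leaves the wanted off-diagonal pair plus a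
diagonal product that 4·1 dominates. -/
theorem smul_one_add_offDiag_mem_sepCone (x y : Fin m × Fin n) {c : ℂ} (hc : ‖c‖ ≤ 1) :
    (4 : ℂ) • 1 + (c • Matrix.vecMulVec (Pi.single x 1) (Pi.single y 1) +
      star c • Matrix.vecMulVec (Pi.single y 1) (Pi.single x 1)) ∈ sepCone m n := by
  obtain ⟨i, j⟩ := x
  obtain ⟨k, l⟩ := y
  let u : ℂ → Fin m → ℂ := fun θ => Pi.single i 1 + θ • Pi.single k 1
  let w : ℂ → Fin n → ℂ := fun θ => Pi.single j 1 + star (c * θ) • Pi.single l 1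
  let T : ℂ → BiMat m n := fun θ =>
    Matrix.vecMulVec (u θ) (star (u θ)) ⊗ₖ Matrix.vecMulVec (w θ) (star (w θ))
  have hT : ∀ θ, T θ ∈ sepCone m n := fun θ => kronecker_mem_sepCone
    (Matrix.posSemidef_vecMulVec_self_star _) (Matrix.posSemidef_vecMulVec_self_star _)
  have h0 : ∀ {s : ℕ} (i x : Fin s), (0 : ℂ) ≤ (Pi.single i 1 : Fin s → ℂ) x := fun i x => by
    simp only [Pi.single_apply]; split_ifs <;> simp
  have h1 : ∀ {s : ℕ} (i x : Fin s), (Pi.single i 1 : Fin s → ℂ) x ≤ 1 := fun i x => by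
    simp only [Pi.single_apply]; split_ifs <;> simp
  have hc' : c * star c ≤ 1 := by
    rw [Complex.star_def, Complex.mul_conj, Complex.normSq_eq_norm_sq]
    exact_mod_cast pow_le_one₀ (norm_nonneg c) hc
  have hD := smul_one_sub_diagonal_kronecker_mem_sepCone (m := m) (n := n)
    (A := Pi.single i 1 + Pi.single k 1) (B := Pi.single j 1 + (c * star c) • Pi.single l 1)
    (fun x => add_nonneg (h0 i x) (h0 k x))
    (fun x => (add_le_add (h1 i x) (h1 k x)).trans_eq (by norm_num))
    (fun x => (add_le_add (h1 j x) (mul_le_one₀ hc' (h0 l x) (h1 l x))).trans_eq (by norm_num))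
  have hsum := smul_mem_sepCone (add_mem (add_mem (hT 1) (hT Complex.I))
    (add_mem (hT (-1)) (hT (-Complex.I)))) (r := 1 / 4) (by norm_num)
  convert add_mem hD hsum using 1
  ext ⟨a, b⟩ ⟨a', b'⟩
  have hp : ∀ (s : Fin m) (t : Fin n) (a : Fin m) (b : Fin n),
      (Pi.single (s, t) 1 : Fin m × Fin n → ℂ) (a, b) =
        (Pi.single s 1 : Fin m → ℂ) a * (Pi.single t 1 : Fin n → ℂ) b := fun s t a b => by
    simp only [Pi.single_apply, Prod.mk.injEq]
    by_cases h1 : a = s <;> by_cases h2 : b = t <;> simp [h1, h2]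
  have hA : (Matrix.diagonal (Pi.single i 1 + Pi.single k 1) : Matrix _ _ ℂ) a a' =
      (Pi.single i 1 : Fin m → ℂ) a * (Pi.single i 1 : Fin m → ℂ) a' +
      (Pi.single k 1 : Fin m → ℂ) a * (Pi.single k 1 : Fin m → ℂ) a' := by
    rw [single_mul_single, single_mul_single, Matrix.diagonal_apply]
    split_ifs <;> simp
  have hB : (Matrix.diagonal (Pi.single j 1 + (c * star c) • Pi.single l 1) : Matrix _ _ ℂ) b b' =
      (Pi.single j 1 : Fin n → ℂ) b * (Pi.single j 1 : Fin n → ℂ) b' + c * star c *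
      ((Pi.single l 1 : Fin n → ℂ) b * (Pi.single l 1 : Fin n → ℂ) b') := by
    rw [single_mul_single, single_mul_single, Matrix.diagonal_apply]
    split_ifs <;> simp
  have hIs : star Complex.I = -Complex.I := Complex.conj_I
  simp only [Matrix.add_apply, Matrix.sub_apply, Matrix.smul_apply, Matrix.kroneckerMap_apply,
    Matrix.vecMulVec_apply, hp, hA, hB, T, u, w, Pi.add_apply, Pi.smul_apply, Pi.star_apply,
    smul_eq_mul, star_add, star_mul', star_single_apply, star_star, star_neg, star_one,
    hIs]
  generalize (Pi.single i 1 : Fin m → ℂ) a = s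
  generalize (Pi.single i 1 : Fin m → ℂ) a' = s'
  generalize (Pi.single k 1 : Fin m → ℂ) a = t
  generalize (Pi.single k 1 : Fin m → ℂ) a' = t'
  generalize (Pi.single j 1 : Fin n → ℂ) b = g
  generalize (Pi.single j 1 : Fin n → ℂ) b' = g'
  generalize (Pi.single l 1 : Fin n → ℂ) b = f
  generalize (Pi.single l 1 : Fin n → ℂ) b' = f'
  generalize star c = c'
  push_cast
  -- With c and its conjugate as independent variables, the identity is polynomial modulo I² = −1.
  linear_combination ((s * t' - t * s') * (c * g * f' - c' * f * g') + c * c' * f * f' * s * s' +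
    g * g' * t * t' + c * c' * f * f' * t * t' * (1 - Complex.I ^ 2)) / 2 * Complex.I_sq

/-- Summing over all (mn)² pairs (x, y) with c = v_x conj(v_y) counts each entry of |v⟩⟨v| twice.
Halving the sum leaves 4(mn)²/2 copies of the identity. -/
theorem smul_one_add_vecMulVec_mem_sepCone {v : Fin m × Fin n → ℂ} (hv : ∀ x, ‖v x‖ ≤ 1) :
    ((2 * (m * n) ^ 2 : ℝ) : ℂ) • 1 + Matrix.vecMulVec v (star v) ∈ sepCone m n := by
  have h := smul_mem_sepCone (r := 1 / 2) (sum_mem fun x (_ : x ∈ Finset.univ) =>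
    sum_mem fun y (_ : y ∈ Finset.univ) => smul_one_add_offDiag_mem_sepCone
      (c := v x * star (v y)) x y
        (by rw [norm_mul, norm_star]; exact mul_le_one₀ (hv x) (norm_nonneg _) (hv y)))
    (by norm_num)
  convert h using 1
  ext z z'
  have e1 : ∑ x, ∑ y, v x * star (v y) * ((Pi.single x 1 : Fin m × Fin n → ℂ) z *
      (Pi.single y 1 : Fin m × Fin n → ℂ) z') = v z * star (v z') := by
    simp [Pi.single_apply]
  have e2 : ∑ x, ∑ y, star (v x) * v y * ((Pi.single y 1 : Fin m × Fin n → ℂ) z *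
      (Pi.single x 1 : Fin m × Fin n → ℂ) z') = v z * star (v z') := by
    simp [Pi.single_apply, mul_comm]
  simp only [Matrix.add_apply, Matrix.smul_apply, Matrix.sum_apply, Matrix.vecMulVec_apply,
    Pi.star_apply, smul_eq_mul, Finset.sum_add_distrib, star_mul', star_star, e1, e2]
  simp only [Finset.sum_const, Finset.card_univ, Fintype.card_prod, Fintype.card_fin, nsmul_eq_mul]
  push_cast
  ring

/-- Mixtures of the vectors of an orthonormal basis with nearly equal weights are separable. -/
theorem isSeparable_mixture [NeZero m] [NeZero n] {p : Fin (m * n) → ℝ}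
    (hp : p ∈ stdSimplex ℝ (Fin (m * n))) {M t : ℝ} (hM : M = 2 * (m * n) ^ 2)
    (ht : t = M / (1 + M * (m * n))) (hpt : ∀ i, t ≤ p i)
    (v : OrthonormalBasis (Fin (m * n)) ℂ (EuclideanSpace ℂ (Fin m × Fin n))) :
    IsSeparable (mixture p v) := by
  have hM0 : 0 ≤ M := by rw [hM]; positivity
  have hone : ∀ x y, (1 : BiMat m n) x y = ∑ i, v i x * star (v i y) := fun x y => by
    rw [← sum_basis_mul_sum v (fun z => (1 : BiMat m n) z y) x]
    simp [Matrix.one_apply]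
  refine isSeparable_of_mem_sepCone ?_ ?_
  -- The mixture equals ∑ (p_i − t)(M·1 + |v_i⟩⟨v_i|). Indeed t solves (1 − mn·t)M = t, so the
  -- identity terms add up to t·1 = ∑ t |v_i⟩⟨v_i|.
  · have hmem := sum_mem (S := sepCone m n) fun i (_ : i ∈ Finset.univ) => smul_mem_sepCone
      (smul_one_add_vecMulVec_mem_sepCone (v := v i) fun x =>
        (PiLp.norm_apply_le (v i) x).trans_eq (v.norm_eq_one i)) (sub_nonneg.2 (hpt i))
    convert hmem using 1
    rw [← hM]
    ext x y
    simp only [mixture, Matrix.of_apply, Matrix.sum_apply, Matrix.smul_apply, Matrix.add_apply,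
      Matrix.vecMulVec_apply, Pi.star_apply, smul_eq_mul, mul_add, Finset.sum_add_distrib]
    rw [← Finset.sum_mul]
    have h1 : ∑ i, (((p i - t : ℝ)) : ℂ) = ((1 - m * n * t : ℝ) : ℂ) := by
      rw [← Complex.ofReal_sum, Finset.sum_sub_distrib, hp.2]
      simp
    have h2 : (1 - m * n * t) * M = t := by
      rw [ht]
      have : (1 + M * (m * n)) ≠ 0 := by positivity
      field_simp
      ring
    rw [h1, ← mul_assoc, ← Complex.ofReal_mul, h2, hone, Finset.mul_sum, ← Finset.sum_add_distrib]
    refine Finset.sum_congr rfl fun i _ => ?_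
    push_cast
    ring
  · have : ∀ i, ∑ x, (p i : ℂ) * v i x * star (v i x) = p i := fun i => by
      have := sum_star_mul_basis v i i
      rw [if_pos rfl] at this
      calc _ = (p i : ℂ) * ∑ x, star (v i x) * v i x := by
            rw [Finset.mul_sum]; exact Finset.sum_congr rfl fun _ _ => by ring
        _ = _ := by rw [this, mul_one]
    simp only [Matrix.trace, Matrix.diag_apply, mixture, Matrix.of_apply]
    rw [Finset.sum_comm]
    simp only [this]
    rw [← Complex.ofReal_sum, hp.2, Complex.ofReal_one]

/-! ### Rényi entropies on 𝓔_d -/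

variable {α : ℝ} {d : ℕ} {p : Fin d → ℝ}

theorem renyi_nonneg (hα₀ : 0 < α) (hα₁ : α ≤ 1) (hp : p ∈ stdSimplex ℝ (Fin d)) :
    0 ≤ renyi α p := by
  have h1 : ∀ i, p i ≤ 1 := fun i => by
    rw [← hp.2]
    exact Finset.single_le_sum (fun j _ => hp.1 j) (Finset.mem_univ i)
  unfold renyi
  split_ifs with h
  · exact Finset.sum_nonneg fun i _ => Real.negMulLog_nonneg (hp.1 i) (h1 i)
  · refine mul_nonneg (inv_nonneg.2 (by linarith)) (Real.log_nonneg ?_)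
    rw [← hp.2]
    refine Finset.sum_le_sum fun i _ => ?_
    rcases (hp.1 i).eq_or_lt with h0 | h0
    · rw [← h0, Real.zero_rpow hα₀.ne']
    · simpa using Real.rpow_le_rpow_of_exponent_ge h0 (h1 i) hα₁

theorem sum_lt_of_strictConcaveOn {φ : ℝ → ℝ} (hφ : StrictConcaveOn ℝ (Set.Ici 0) φ)
    (hp : p ∈ stdSimplex ℝ (Fin d)) (hne : ∃ i j, p i ≠ p j) :
    ∑ i, φ (p i) < d * φ (d : ℝ)⁻¹ := by
  obtain ⟨i, j, hij⟩ := hne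
  have hd : (0 : ℝ) < d := by exact_mod_cast i.pos
  have := hφ.lt_map_sum (t := Finset.univ) (w := fun _ : Fin d => (d : ℝ)⁻¹) (p := p)
    (fun _ _ => by positivity) (by simp [hd.ne']) (fun k _ => hp.1 k)
    ⟨i, Finset.mem_univ _, j, Finset.mem_univ _, hij⟩
  simp only [smul_eq_mul, ← Finset.mul_sum, hp.2, mul_one] at this
  rwa [inv_mul_lt_iff₀ hd] at this

/-- Strict Jensen inequality for −x ln x or, if α < 1, for x^α; then the logarithm and the factor
1/(1 − α) > 0 preserve the order. -/
theorem renyi_lt_renyi_uniform (hα₀ : 0 < α) (hα₁ : α ≤ 1) (hp : p ∈ stdSimplex ℝ (Fin d))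
    (hne : ∃ i j, p i ≠ p j) : renyi α p < renyi α (fun _ : Fin d => (d : ℝ)⁻¹) := by
  unfold renyi
  split_ifs with h
  · simpa using sum_lt_of_strictConcaveOn Real.strictConcaveOn_negMulLog hp hne
  · have hα : α < 1 := lt_of_le_of_ne hα₁ h
    refine mul_lt_mul_of_pos_left (Real.log_lt_log ?_ ?_) (inv_pos.2 (by linarith))
    · have : ∃ i, 0 < p i := by
        by_contra! h0
        have := Finset.sum_nonpos fun i (_ : i ∈ Finset.univ) => h0 i
        linarith [hp.2]
      obtain ⟨i, hi⟩ := this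
      exact Finset.sum_pos' (fun j _ => Real.rpow_nonneg (hp.1 j) _)
        ⟨i, Finset.mem_univ _, Real.rpow_pos_of_pos hi _⟩
    · simpa using sum_lt_of_strictConcaveOn (Real.strictConcaveOn_rpow hα₀ hα) hp hne

theorem convex_probVec (d : ℕ) : Convex ℝ (probVec d) := by
  refine (convex_stdSimplex ℝ (Fin d)).inter fun p hp q hq a b ha hb _ i j hij => ?_
  simp only [Pi.add_apply, Pi.smul_apply, smul_eq_mul]
  exact add_le_add (mul_le_mul_of_nonneg_left (hp hij) ha) (mul_le_mul_of_nonneg_left (hq hij) hb)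

theorem isCompact_probVec (d : ℕ) : IsCompact (probVec d) := by
  exact (isCompact_stdSimplex ℝ (Fin d)).inter_right isClosed_antitone

theorem uniform_mem_probVec (hd : 0 < d) : (fun _ : Fin d => (d : ℝ)⁻¹) ∈ probVec d :=
  ⟨⟨fun _ => by positivity, by simp [hd.ne']⟩, antitone_const⟩

/-! ### Spectral decomposition with ordered eigenvalues -/

variable {m n : ℕ}

theorem exists_eq_mixture {σ : BiMat m n} (hσ : IsDensity σ) :
    ∃ p ∈ probVec (m * n),
      ∃ v : OrthonormalBasis (Fin (m * n)) ℂ (EuclideanSpace ℂ (Fin m × Fin n)),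
        σ = mixture p v := by
  have hH := hσ.1.1
  let q : Fin (m * n) → ℝ := hH.eigenvalues ∘ finProdFinEquiv.symm
  -- Sorting −q increasingly puts the eigenvalues in decreasing order.
  let τ : Equiv.Perm (Fin (m * n)) := Tuple.sort (-q)
  let e : Fin (m * n) ≃ Fin m × Fin n := τ.trans finProdFinEquiv.symm
  refine ⟨fun i => hH.eigenvalues (e i), ⟨⟨fun i => hσ.1.eigenvalues_nonneg _, ?_⟩,
    fun i j hij => ?_⟩, hH.eigenvectorBasis.reindex e.symm, ?_⟩
  · rw [e.sum_comp hH.eigenvalues]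
    have h1 : σ.trace = 1 := (hasSum_fintype _).unique hσ.2
    rw [hH.trace_eq_sum_eigenvalues] at h1
    exact Complex.ofReal_injective (by simpa using h1)
  · have : (-q ∘ τ) i ≤ (-q ∘ τ) j := Tuple.monotone_sort (-q) hij
    exact neg_le_neg_iff.1 this
  · ext x y
    conv_lhs => rw [hH.spectral_theorem]
    simp only [mixture, Matrix.of_apply, OrthonormalBasis.reindex_apply, Equiv.symm_symm]
    rw [e.sum_comp fun i => (hH.eigenvalues i : ℂ) * hH.eigenvectorBasis i x *
      star (hH.eigenvectorBasis i y)]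
    rw [Unitary.conjStarAlgAut_apply, Matrix.mul_apply]
    refine Finset.sum_congr rfl fun i _ => ?_
    rw [Matrix.mul_diagonal]
    simp only [Matrix.star_apply, Matrix.IsHermitian.eigenvectorUnitary_apply, Function.comp_apply]
    exact congrArg (· * _) (mul_comm _ _)

end InternalEntanglement

/-! ### The threshold -/

open InternalEntanglement in
theorem mainTheorem5
    (C : CorrelationMeasure) (hC : IsCorrelationMonotone C)
    (hf : ∀ d : ℕ, ContinuousOn (fun p : Fin d → ℝ => pureValue C p) (probVec d))
    (α : ℝ) (hα₀ : 0 < α) (hα₁ : α ≤ 1)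
    (k : ℝ → ℝ) (hk : StrictMonoOn k (Set.Ici 0))
    (hfk : ∀ d : ℕ, ∀ p ∈ probVec d, pureValue C p = k (renyi α p))
    (d₁ d₂ : ℕ) (hd₁ : 2 ≤ d₁) (hd₂ : d₁ ≤ d₂)
    (E : EntanglementMeasure) (hE : IsEntanglementMonotone E) :
    ∃ x₀ : ℝ, 0 ≤ x₀ ∧ x₀ < corrMax C (d₁ * d₂) ∧
      (∀ x ∈ Set.Icc x₀ (corrMax C (d₁ * d₂)), xi C E d₁ d₂ x = 0) ∧
      ∀ (b : Type) (ρ : Matrix ((Fin d₁ × Fin d₂) × b) ((Fin d₁ × Fin d₂) × b) ℂ),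
        IsDensity ρ → x₀ ≤ C (Fin d₁ × Fin d₂) b ρ → E d₁ d₂ (reduced ρ) = 0 := by
  have : NeZero d₁ := ⟨by omega⟩
  have : NeZero d₂ := ⟨by omega⟩
  have hd : 1 < d₁ * d₂ := by nlinarith
  set d := d₁ * d₂ with hdd
  have hdR : (d : ℝ) = d₁ * d₂ := by rw [hdd]; push_cast; rfl
  set M : ℝ := 2 * (d₁ * d₂) ^ 2 with hM
  set t : ℝ := M / (1 + M * (d₁ * d₂)) with ht
  have hM0 : 0 ≤ M := by positivity
  have hd0 : (0 : ℝ) < d := by positivity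
  have ht1 : t < (d : ℝ)⁻¹ := by
    rw [ht, ← hdR, div_lt_iff₀ (by positivity)]
    field_simp
    linarith
  have hsep : ∀ p ∈ probVec d, (∀ i, t ≤ p i) → ∀ v, E d₁ d₂ (mixture p v) = 0 :=
    fun p hp hpt v => hE.separable _ _ _ (isSeparable_mixture hp.1 hM ht hpt v)
  have hu : (fun _ : Fin d => (d : ℝ)⁻¹) ∈ probVec d := uniform_mem_probVec (by omega)
  -- the vectors with a component at most `t` are bounded away from the maximum of `f`
  obtain ⟨p₁, hp₁, hp₁u, hmax⟩ : ∃ p₁ ∈ probVec d,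
      pureValue C p₁ < pureValue C (fun _ : Fin d => (d : ℝ)⁻¹) ∧
      ∀ p ∈ probVec d, (∃ i, p i ≤ t) → pureValue C p ≤ pureValue C p₁ := by
    have hlt : ∀ p ∈ probVec d, (∃ i, p i ≤ t) →
        pureValue C p < pureValue C (fun _ : Fin d => (d : ℝ)⁻¹) := fun p hp ⟨i, hi⟩ => by
      rw [hfk d p hp, hfk d _ hu]
      refine hk (renyi_nonneg hα₀ hα₁ hp.1) (renyi_nonneg hα₀ hα₁ hu.1)
        (renyi_lt_renyi_uniform hα₀ hα₁ hp.1 ?_)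
      by_contra! h
      have h2 := hp.1.2
      rw [Finset.sum_congr rfl fun j _ => h j i] at h2
      simp only [Finset.sum_const, Finset.card_univ, Fintype.card_fin, nsmul_eq_mul] at h2
      have : p i = (d : ℝ)⁻¹ := eq_inv_of_mul_eq_one_right h2
      linarith
    have hcl : IsClosed {p : Fin d → ℝ | ∃ i, p i ≤ t} := by
      have : {p : Fin d → ℝ | ∃ i, p i ≤ t} = ⋃ i, {p | p i ≤ t} := by ext; simp
      rw [this]
      exact isClosed_iUnion_of_finite fun i => isClosed_le (continuous_apply i) continuous_const
    have hK := (isCompact_probVec d).inter_right hcl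
    -- The vertex (1, 0, …, 0) belongs to this set, since d > 1 and t ≥ 0.
    have h : (probVec d ∩ {p : Fin d → ℝ | ∃ i, p i ≤ t}).Nonempty := by
      refine ⟨Pi.single ⟨0, by omega⟩ 1, ⟨single_mem_stdSimplex ℝ _, fun i j hij => ?_⟩,
        ⟨1, hd⟩, ?_⟩
      · simp only [Pi.single_apply, Fin.ext_iff]
        have : (i : ℕ) ≤ j := hij
        split_ifs <;> first | omega | norm_num
      · simp only [Pi.single_apply, Fin.ext_iff, one_ne_zero, if_false]
        positivity
    obtain ⟨p₁, hp₁, hmax⟩ := hK.exists_isMaxOn h ((hf d).mono Set.inter_subset_left)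
    exact ⟨p₁, hp₁.1, hlt p₁ hp₁.1 hp₁.2, fun p hp hpt => hmax ⟨hp, hpt⟩⟩
  have hp₁0 : 0 ≤ pureValue C p₁ := hC.nonneg _ _ _ (isDensity_schmidtVec hp₁.1)
  have himg := (isCompact_probVec d).image_of_continuousOn (hf d)
  have hbdd : BddAbove (pureValue C '' probVec d) := himg.bddAbove
  have huc : pureValue C (fun _ : Fin d => (d : ℝ)⁻¹) ≤ corrMax C d :=
    le_csSup hbdd ⟨_, hu, rfl⟩
  obtain ⟨x₀, hyx, hxu⟩ := exists_between hp₁u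
  have hbig : ∀ p ∈ probVec d, x₀ ≤ pureValue C p → ∀ i, t ≤ p i := fun p hp hx i => by
    by_contra! h
    exact absurd (hmax p hp ⟨i, h.le⟩) (by linarith)
  refine ⟨x₀, by linarith, by linarith, fun x hx => ?_, fun b ρ hρ hx => ?_⟩
  · obtain ⟨p₂, hp₂, hmax₂⟩ := himg.sSup_mem (Set.Nonempty.image _ ⟨_, hu⟩)
    -- The level set f = x must be nonempty, since the infimum of the empty set is 0 by convention.
    -- The convex set 𝓔_d is connected and f(p₁) < x₀ ≤ x ≤ c_d = f(p₂), so x is attained.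
    obtain ⟨q, hq, hqx⟩ := (convex_probVec d).isPreconnected.intermediate_value hp₁ hp₂ (hf d)
      ⟨hyx.le.trans hx.1, hx.2.trans_eq hmax₂.symm⟩
    have h0 : ∀ p ∈ probVec d, pureValue C p = x → mixedness E d₁ d₂ p = entMax E d₁ d₂ :=
      fun p hp hpx => by
        simp only [mixedness, hsep p hp (hbig p hp (hx.1.trans_eq hpx.symm)), Real.iSup_const_zero,
          sub_zero]
    -- On this level set s is constantly e, so e cancels in ξ whatever its value.
    have h1 : mixedness E d₁ d₂ '' {p | p ∈ probVec d ∧ pureValue C p = x} = {entMax E d₁ d₂} := by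
      refine Set.eq_singleton_iff_unique_mem.2 ⟨⟨q, ⟨hq, hqx⟩, h0 q hq hqx⟩, ?_⟩
      rintro _ ⟨p, ⟨hp, hpx⟩, rfl⟩
      exact h0 p hp hpx
    rw [xi, minMixedness, h1, csInf_singleton, sub_self]
  · obtain ⟨p, hp, v, hv⟩ := exists_eq_mixture hρ.reduced
    rw [hv]
    refine hsep p hp (hbig p hp (hx.trans (hC.le_pureValue hρ hp.1 (v := v) fun i j => ?_))) v
    rw [hv]
    rfl
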